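/- Let $\Bbbk$ be a field, let $q\in\Bbbk^\times$ be a root of unity with $q\neq 1$, and let $h=\sum_{i=0}^d c_it^i\in\Bbbk[t]$ be a nonconstant polynomial of degree $d$. Let $\sigma$ be the automorphism of $\Bbbk[t]$ with $\sigma(t)=qt$, and let $W=\Bbbk[t](x,y,\sigma,h)$ be the degree one quantum generalized Weyl algebra, that is, the $\Bbbk$-algebra generated over $\Bbbk[t]$ by $x$ and $y$ subject to $$xy=h,\qquad yx=\sigma^{-1}(h),\qquad xr=\sigma(r)x,\qquad yr=\sigma^{-1}(r)y\qquad (r\in\Bbbk[t]).$$ Put $g=\gcd\{j-i \mid i<j,\ c_ic_j\neq 0\}$ (with $g=0$ if $h$ is a monomial) and $C_g=\{\gamma\in\Bbbk^\times\mid\gamma^g=1\}$ (so $C_0=\Bbbk^\times$). For $\gamma\in C_g$ and $\mu\in\Bbbk^\times$ let $\eta_{\gamma,\mu}$ be the $\Bbbk$-algebra automorphism of $W$ with $$\eta_{\gamma,\mu}(x)=\mu x,\qquad \eta_{\gamma,\mu}(y)=\mu^{-1}\gamma^d y,\qquad \eta_{\gamma,\mu}(t)=\gamma t,$$ and let $G$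 be the subgroup of the group $\operatorname{Aut}(W)$ of $\Bbbk$-algebra automorphisms that consists of all the $\eta_{\gamma,\mu}$. If $q=-1$, let $\Omega$ be the $\Bbbk$-algebra automorphism of $W$ with $\Omega(x)=y$, $\Omega(y)=x$, $\Omega(t)=-t$. (a) If $q^2\neq 1$, then $\operatorname{Aut}(W)=G$. (b) If $q=-1$, then $\operatorname{Aut}(W)\cong G\rtimes\mathbb{Z}/2\mathbb{Z}$, where $\mathbb{Z}/2\mathbb{Z}$ is generated by $\Omega$. More precisely, for some action of $\mathbb{Z}/2\mathbb{Z}$ on $G$ there is a group isomorphism $G\rtimes\mathbb{Z}/2\mathbb{Z}\to\operatorname{Aut}(W)$ that restricts to the inclusion on $G$ and sends the generator of $\mathbb{Z}/2\mathbb{Z}$ to $\Omega$. -/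

import Mathlib

open Polynomial

universe u v w

section GeneralizedWeylAlgebra

/-- Generators of a degree one generalized Weyl algebra over `R`: all elements of `R`,
together with two further letters `x` and `y`. -/
inductive GWAGen (R : Type v) : Type v
  | base (r : R) : GWAGen R
  | x : GWAGen R
  | y : GWAGen R

/-- Defining relations of the generalized Weyl algebra `R(x, y, σ, h)` of degree one.
The first three say that `R` maps to the quotient by a homomorphism of `k`-algebras. -/
inductive GWARel {k : Type u} {R : Type v} [Field k] [CommRing R] [Algebra k R]
    (σ : R ≃ₐ[k] R) (h : R) : FreeAlgebra k (GWAGen R) → FreeAlgebra k (GWAGen R) → Prop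
  | base_algebraMap (c : k) : GWARel σ h
      (FreeAlgebra.ι k (GWAGen.base (algebraMap k R c))) (algebraMap k _ c)
  | base_add (r s : R) : GWARel σ h (FreeAlgebra.ι k (GWAGen.base (r + s)))
      (FreeAlgebra.ι k (GWAGen.base r) + FreeAlgebra.ι k (GWAGen.base s))
  | base_mul (r s : R) : GWARel σ h (FreeAlgebra.ι k (GWAGen.base (r * s)))
      (FreeAlgebra.ι k (GWAGen.base r) * FreeAlgebra.ι k (GWAGen.base s))
  | x_mul_y : GWARel σ h (FreeAlgebra.ι k GWAGen.x * FreeAlgebra.ι k GWAGen.y)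
      (FreeAlgebra.ι k (GWAGen.base h))
  | y_mul_x : GWARel σ h (FreeAlgebra.ι k GWAGen.y * FreeAlgebra.ι k GWAGen.x)
      (FreeAlgebra.ι k (GWAGen.base (σ.symm h)))
  | x_mul_base (r : R) : GWARel σ h
      (FreeAlgebra.ι k GWAGen.x * FreeAlgebra.ι k (GWAGen.base r))
      (FreeAlgebra.ι k (GWAGen.base (σ r)) * FreeAlgebra.ι k GWAGen.x)
  | y_mul_base (r : R) : GWARel σ h
      (FreeAlgebra.ι k GWAGen.y * FreeAlgebra.ι k (GWAGen.base r))
      (FreeAlgebra.ι k (GWAGen.base (σ.symm r)) * FreeAlgebra.ι k GWAGen.y)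

/-- The generalized Weyl algebra `R(x, y, σ, h)` of degree one: the `k`-algebra generated
over `R` by `x, y` subject to `xy = h`, `yx = σ⁻¹(h)`, `xr = σ(r)x`, `yr = σ⁻¹(r)y`. -/
def GWA {k : Type u} {R : Type v} [Field k] [CommRing R] [Algebra k R]
    (σ : R ≃ₐ[k] R) (h : R) : Type (max u v) :=
  RingQuot (GWARel σ h)

namespace GWA

variable {k : Type u} {R : Type v} [Field k] [CommRing R] [Algebra k R]
  (σ : R ≃ₐ[k] R) (h : R)

instance instRing : Ring (GWA σ h) := inferInstanceAs (Ring (RingQuot (GWARel σ h)))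

instance instAlgebra : Algebra k (GWA σ h) :=
  inferInstanceAs (Algebra k (RingQuot (GWARel σ h)))

/-- The quotient map from the free algebra. -/
def mk : FreeAlgebra k (GWAGen R) →ₐ[k] GWA σ h := RingQuot.mkAlgHom k (GWARel σ h)

theorem mk_rel {a b : FreeAlgebra k (GWAGen R)} (hab : GWARel σ h a b) :
    mk σ h a = mk σ h b := RingQuot.mkAlgHom_rel k hab

/-- The structure homomorphism `R → R(x, y, σ, h)`. -/
def base : R →ₐ[k] GWA σ h :=
  AlgHom.ofLinearMap
    { toFun := fun r => mk σ h (FreeAlgebra.ι k (GWAGen.base r))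
      map_add' := fun r s => by rw [mk_rel σ h (GWARel.base_add r s), map_add]
      map_smul' := fun c r => by
        rw [Algebra.smul_def, mk_rel σ h (GWARel.base_mul _ r), map_mul,
          mk_rel σ h (GWARel.base_algebraMap c), AlgHom.commutes, RingHom.id_apply,
          Algebra.smul_def] }
    (by
      have := mk_rel σ h (GWARel.base_algebraMap (1 : k))
      simpa using this)
    (fun r s => by
      change mk σ h _ = mk σ h _ * mk σ h _
      rw [mk_rel σ h (GWARel.base_mul r s), map_mul])

/-- The generator `x`. -/
def x : GWA σ h := mk σ h (FreeAlgebra.ι k GWAGen.x)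

/-- The generator `y`. -/
def y : GWA σ h := mk σ h (FreeAlgebra.ι k GWAGen.y)

theorem mk_base (r : R) : mk σ h (FreeAlgebra.ι k (GWAGen.base r)) = base σ h r := rfl

theorem x_mul_y : x σ h * y σ h = base σ h h := by
  rw [x, y, ← map_mul, mk_rel σ h GWARel.x_mul_y, mk_base]

theorem y_mul_x : y σ h * x σ h = base σ h (σ.symm h) := by
  rw [x, y, ← map_mul, mk_rel σ h GWARel.y_mul_x, mk_base]

theorem x_mul_base (r : R) : x σ h * base σ h r = base σ h (σ r) * x σ h := by
  rw [x, ← mk_base, ← mk_base, ← map_mul, mk_rel σ h (GWARel.x_mul_base r), map_mul]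

theorem y_mul_base (r : R) : y σ h * base σ h r = base σ h (σ.symm r) * y σ h := by
  rw [y, ← mk_base, ← mk_base, ← map_mul, mk_rel σ h (GWARel.y_mul_base r), map_mul]

/-- The universal property of `R(x, y, σ, h)`. -/
def lift {A : Type w} [Ring A] [Algebra k A] (f : R →ₐ[k] A) (a b : A)
    (hab : a * b = f h) (hba : b * a = f (σ.symm h))
    (ha : ∀ r, a * f r = f (σ r) * a) (hb : ∀ r, b * f r = f (σ.symm r) * b) :
    GWA σ h →ₐ[k] A :=
  RingQuot.liftAlgHom k (s := GWARel σ h)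
    ⟨FreeAlgebra.lift k (fun z => match z with
        | GWAGen.base r => f r
        | GWAGen.x => a
        | GWAGen.y => b), by
      intro p q hpq
      induction hpq <;> simp [*]⟩

section lift

variable {A : Type w} [Ring A] [Algebra k A] (f : R →ₐ[k] A) (a b : A)
    (hab : a * b = f h) (hba : b * a = f (σ.symm h))
    (ha : ∀ r, a * f r = f (σ r) * a) (hb : ∀ r, b * f r = f (σ.symm r) * b)

theorem lift_base (r : R) : lift σ h f a b hab hba ha hb (base σ h r) = f r := by
  change RingQuot.liftAlgHom k _ (RingQuot.mkAlgHom k (GWARel σ h) _) = _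
  rw [RingQuot.liftAlgHom_mkAlgHom_apply, FreeAlgebra.lift_ι_apply]

theorem lift_x : lift σ h f a b hab hba ha hb (x σ h) = a := by
  change RingQuot.liftAlgHom k _ (RingQuot.mkAlgHom k (GWARel σ h) _) = _
  rw [RingQuot.liftAlgHom_mkAlgHom_apply, FreeAlgebra.lift_ι_apply]

theorem lift_y : lift σ h f a b hab hba ha hb (y σ h) = b := by
  change RingQuot.liftAlgHom k _ (RingQuot.mkAlgHom k (GWARel σ h) _) = _
  rw [RingQuot.liftAlgHom_mkAlgHom_apply, FreeAlgebra.lift_ι_apply]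

end lift

theorem hom_ext {A : Type w} [Ring A] [Algebra k A] {f g : GWA σ h →ₐ[k] A}
    (hR : ∀ r, f (base σ h r) = g (base σ h r))
    (hx : f (x σ h) = g (x σ h)) (hy : f (y σ h) = g (y σ h)) : f = g := by
  refine RingQuot.ringQuot_ext' k (s := GWARel σ h) f g ?_
  refine FreeAlgebra.hom_ext (funext fun z => ?_)
  cases z with
  | base r => exact hR r
  | x => exact hx
  | y => exact hy

end GWA

end GeneralizedWeylAlgebra

section QuantumGWA

/-- The automorphism of `k[t]` with `t ↦ q t`. -/
noncomputable def scaleAut {k : Type u} [Field k] (q : kˣ) : k[X] ≃ₐ[k] k[X] :=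
  AlgEquiv.ofAlgHom (aeval (C (q : k) * X)) (aeval (C ((q⁻¹ : kˣ) : k) * X))
    (by ext; simp [← mul_assoc, ← C_mul])
    (by ext; simp [← mul_assoc, ← C_mul])

theorem scaleAut_X {k : Type u} [Field k] (q : kˣ) :
    scaleAut q X = C (q : k) * X := by
  simp [scaleAut]

theorem scaleAut_symm {k : Type u} [Field k] (q : kˣ) :
    (scaleAut q).symm = scaleAut q⁻¹ := by
  ext
  simp [scaleAut]

theorem scaleAut_comm {k : Type u} [Field k] (p q : kˣ) (r : k[X]) :
    scaleAut p (scaleAut q r) = scaleAut q (scaleAut p r) := by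
  have : (scaleAut p).toAlgHom.comp (scaleAut q).toAlgHom =
      (scaleAut q).toAlgHom.comp (scaleAut p).toAlgHom := by
    ext
    simp [scaleAut, mul_left_comm]
  exact DFunLike.congr_fun this r

theorem scaleAut_coeff {k : Type u} [Field k] (q : kˣ) (r : k[X]) (n : ℕ) :
    (scaleAut q r).coeff n = (q : k) ^ n * r.coeff n := by
  have : scaleAut q r = r.comp (C (q : k) * X) := by
    simp [scaleAut, aeval_def, comp, Polynomial.algebraMap_eq]
  rw [this, comp_C_mul_X_coeff, mul_comm]

/-- The quantum generalized Weyl algebra `W = k[t](x, y, σ, h)` of degree one, `σ(t) = q t`. -/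
abbrev QuantumGWA {k : Type u} [Field k] (q : kˣ) (h : k[X]) : Type u :=
  GWA (scaleAut q) h

namespace QuantumGWA

variable {k : Type u} [Field k] (q : kˣ) (h : k[X])

/-- The generator `x` of `W`. -/
noncomputable abbrev x : QuantumGWA q h := GWA.x (scaleAut q) h

/-- The generator `y` of `W`. -/
noncomputable abbrev y : QuantumGWA q h := GWA.y (scaleAut q) h

/-- The element `t` of `W`. -/
noncomputable abbrev t : QuantumGWA q h := GWA.base (scaleAut q) h X

theorem hom_ext {A : Type w} [Ring A] [Algebra k A] {f g : QuantumGWA q h →ₐ[k] A}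
    (hx : f (x q h) = g (x q h)) (hy : f (y q h) = g (y q h))
    (ht : f (t q h) = g (t q h)) : f = g := by
  refine GWA.hom_ext (scaleAut q) h (fun r => ?_) hx hy
  have : f.comp (GWA.base (scaleAut q) h) = g.comp (GWA.base (scaleAut q) h) := by
    ext
    simpa using ht
  exact DFunLike.congr_fun this r

theorem equiv_ext {f g : QuantumGWA q h ≃ₐ[k] QuantumGWA q h}
    (hx : f (x q h) = g (x q h)) (hy : f (y q h) = g (y q h))
    (ht : f (t q h) = g (t q h)) : f = g := by
  have := hom_ext q h (f := (f : QuantumGWA q h →ₐ[k] QuantumGWA q h))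
    (g := (g : QuantumGWA q h →ₐ[k] QuantumGWA q h)) hx hy ht
  exact AlgEquiv.ext fun z => DFunLike.congr_fun this z

/-- For `h = ∑ cᵢ tⁱ`, the number `g = gcd {j - i | i < j, cᵢ cⱼ ≠ 0}`. If `h` is a monomial
the set is empty and `g = 0`. -/
def gapGcd {k : Type u} [Field k] (h : k[X]) : ℕ :=
  ((h.support ×ˢ h.support).filter (fun p => p.1 < p.2)).gcd (fun p => p.2 - p.1)

/-- The group `C_g` of `g`-th roots of `1` in `k`; it is all of `kˣ` if `g = 0`. -/
def Cg {k : Type u} [Field k] (h : k[X]) : Subgroup kˣ := rootsOfUnity (gapGcd h) k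

theorem pow_eq_of_mem_Cg {h : k[X]} {γ : kˣ} (hγ : γ ∈ Cg h) {i : ℕ} (hi : i ∈ h.support) :
    γ ^ i = γ ^ h.natDegree := by
  rcases (le_natDegree_of_mem_supp i hi).eq_or_lt with hid | hid
  · rw [hid]
  · have hd : h.natDegree ∈ h.support :=
      natDegree_mem_support_of_nonzero (by rintro rfl; simp at hi)
    have hdvd : gapGcd h ∣ h.natDegree - i :=
      Finset.gcd_dvd (f := fun p : ℕ × ℕ => p.2 - p.1) (b := (i, h.natDegree))
        (Finset.mem_filter.2 ⟨Finset.mk_mem_product hi hd, hid⟩)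
    obtain ⟨m, hm⟩ := hdvd
    have h1 : γ ^ gapGcd h = 1 := (mem_rootsOfUnity _ _).1 hγ
    have h2 : h.natDegree = i + gapGcd h * m := by omega
    rw [h2, pow_add, pow_mul, h1, one_pow, mul_one]

theorem scaleAut_of_mem_Cg {h : k[X]} {γ : kˣ} (hγ : γ ∈ Cg h) :
    scaleAut γ h = ((γ : k) ^ h.natDegree) • h := by
  ext n
  rw [scaleAut_coeff, coeff_smul, smul_eq_mul]
  by_cases hn : n ∈ h.support
  · have := congrArg (Units.val) (pow_eq_of_mem_Cg hγ hn)
    push_cast at this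
    rw [this]
  · rw [notMem_support_iff.1 hn, mul_zero, mul_zero]

/-- The endomorphism of `W` with `x ↦ μ x`, `y ↦ μ⁻¹ γᵈ y`, `t ↦ γ t`, where `d = deg h`. -/
noncomputable def etaHom (γ μ : kˣ) (hγ : γ ∈ Cg h) :
    QuantumGWA q h →ₐ[k] QuantumGWA q h :=
  GWA.lift (scaleAut q) h ((GWA.base (scaleAut q) h).comp (scaleAut γ).toAlgHom)
    ((μ : k) • x q h) (((μ⁻¹ * γ ^ h.natDegree : kˣ) : k) • y q h)
    (by
      rw [smul_mul_smul_comm, GWA.x_mul_y, ← Units.val_mul, mul_inv_cancel_left]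
      simp [scaleAut_of_mem_Cg hγ])
    (by
      rw [smul_mul_smul_comm, GWA.y_mul_x, mul_comm, ← Units.val_mul, mul_inv_cancel_left]
      simp [scaleAut_symm, scaleAut_comm γ q⁻¹, scaleAut_of_mem_Cg hγ])
    (by
      intro r
      simp [GWA.x_mul_base, scaleAut_comm γ q])
    (by
      intro r
      simp [GWA.y_mul_base, scaleAut_symm, scaleAut_comm γ q⁻¹])

theorem etaHom_x (γ μ : kˣ) (hγ : γ ∈ Cg h) :
    etaHom q h γ μ hγ (x q h) = (μ : k) • x q h := GWA.lift_x ..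

theorem etaHom_y (γ μ : kˣ) (hγ : γ ∈ Cg h) :
    etaHom q h γ μ hγ (y q h) = ((μ⁻¹ * γ ^ h.natDegree : kˣ) : k) • y q h := GWA.lift_y ..

theorem etaHom_t (γ μ : kˣ) (hγ : γ ∈ Cg h) :
    etaHom q h γ μ hγ (t q h) = (γ : k) • t q h := by
  refine (GWA.lift_base ..).trans ?_
  simp [scaleAut_X, ← smul_eq_C_mul]

/-- The automorphism `η_{γ,μ}` of `W` (`γ ∈ C_g`, `μ ∈ kˣ`) with
`x ↦ μ x`, `y ↦ μ⁻¹ γᵈ y`, `t ↦ γ t`, where `d = deg h`. -/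
noncomputable def eta (γ μ : kˣ) (hγ : γ ∈ Cg h) : QuantumGWA q h ≃ₐ[k] QuantumGWA q h :=
  AlgEquiv.ofAlgHom (etaHom q h γ μ hγ) (etaHom q h γ⁻¹ μ⁻¹ (inv_mem hγ))
    (by
      refine hom_ext q h ?_ ?_ ?_ <;>
        simp only [AlgHom.comp_apply, etaHom_x, etaHom_y, etaHom_t, map_smul, smul_smul,
          ← Units.val_mul, inv_pow, inv_inv, AlgHom.id_apply] <;>
        simp [-Units.val_mul, mul_mul_mul_comm])
    (by
      refine hom_ext q h ?_ ?_ ?_ <;>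
        simp only [AlgHom.comp_apply, etaHom_x, etaHom_y, etaHom_t, map_smul, smul_smul,
          ← Units.val_mul, inv_pow, inv_inv, AlgHom.id_apply] <;>
        simp [-Units.val_mul, mul_mul_mul_comm])

theorem eta_x (γ μ : kˣ) (hγ : γ ∈ Cg h) :
    eta q h γ μ hγ (x q h) = (μ : k) • x q h := etaHom_x ..

theorem eta_y (γ μ : kˣ) (hγ : γ ∈ Cg h) :
    eta q h γ μ hγ (y q h) = ((μ⁻¹ * γ ^ h.natDegree : kˣ) : k) • y q h := etaHom_y ..

theorem eta_t (γ μ : kˣ) (hγ : γ ∈ Cg h) :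
    eta q h γ μ hγ (t q h) = (γ : k) • t q h := etaHom_t ..

theorem eta_mul (γ μ γ' μ' : kˣ) (hγ : γ ∈ Cg h) (hγ' : γ' ∈ Cg h) :
    eta q h γ μ hγ * eta q h γ' μ' hγ' = eta q h (γ * γ') (μ * μ') (mul_mem hγ hγ') := by
  refine equiv_ext q h ?_ ?_ ?_ <;>
    simp only [AlgEquiv.mul_apply, eta_x, eta_y, eta_t, map_smul, smul_smul,
      ← Units.val_mul, mul_pow, mul_inv] <;>
    congr 2 <;> simp only [mul_assoc, mul_comm, mul_left_comm]

theorem eta_one : eta q h 1 1 (one_mem _) = 1 := by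
  refine equiv_ext q h ?_ ?_ ?_ <;> simp [eta_x, eta_y, eta_t]

/-- The subgroup `G` of `Aut(W)` consisting of the automorphisms `η_{γ,μ}`. -/
def G : Subgroup (QuantumGWA q h ≃ₐ[k] QuantumGWA q h) where
  carrier := {φ | ∃ (γ μ : kˣ) (hγ : γ ∈ Cg h), φ = eta q h γ μ hγ}
  mul_mem' := by
    rintro _ _ ⟨γ, μ, hγ, rfl⟩ ⟨γ', μ', hγ', rfl⟩
    exact ⟨_, _, _, eta_mul ..⟩
  one_mem' := ⟨1, 1, one_mem _, (eta_one q h).symm⟩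
  inv_mem' := by
    rintro _ ⟨γ, μ, hγ, rfl⟩
    refine ⟨γ⁻¹, μ⁻¹, inv_mem hγ, inv_eq_of_mul_eq_one_right ?_⟩
    rw [eta_mul]
    refine equiv_ext q h ?_ ?_ ?_ <;> simp [eta_x, eta_y, eta_t]

/-- For `q = -1`, the endomorphism of `W` with `x ↦ y`, `y ↦ x`, `t ↦ -t`. -/
noncomputable def OmegaHom (hq : q = -1) : QuantumGWA q h →ₐ[k] QuantumGWA q h :=
  GWA.lift (scaleAut q) h ((GWA.base (scaleAut q) h).comp (scaleAut (-1)).toAlgHom)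
    (y q h) (x q h)
    (by
      subst hq
      simp [GWA.y_mul_x, scaleAut_symm])
    (by
      subst hq
      rw [GWA.x_mul_y]
      exact congrArg (GWA.base (scaleAut (-1)) h)
        ((scaleAut (-1)).apply_symm_apply h).symm)
    (by
      subst hq
      intro r
      simp [GWA.y_mul_base, scaleAut_symm])
    (by
      subst hq
      intro r
      simp [GWA.x_mul_base, scaleAut_symm])

theorem OmegaHom_x (hq : q = -1) : OmegaHom q h hq (x q h) = y q h := GWA.lift_x ..

theorem OmegaHom_y (hq : q = -1) : OmegaHom q h hq (y q h) = x q h := GWA.lift_y ..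

theorem OmegaHom_t (hq : q = -1) : OmegaHom q h hq (t q h) = -t q h := by
  refine (GWA.lift_base ..).trans ?_
  simp [scaleAut_X]

/-- For `q = -1`, the automorphism `Ω` of `W` with `x ↦ y`, `y ↦ x`, `t ↦ -t`. -/
noncomputable def Omega (hq : q = -1) : QuantumGWA q h ≃ₐ[k] QuantumGWA q h :=
  AlgEquiv.ofAlgHom (OmegaHom q h hq) (OmegaHom q h hq)
    (by refine hom_ext q h ?_ ?_ ?_ <;> simp [OmegaHom_x, OmegaHom_y, OmegaHom_t])
    (by refine hom_ext q h ?_ ?_ ?_ <;> simp [OmegaHom_x, OmegaHom_y, OmegaHom_t])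

theorem Omega_x (hq : q = -1) : Omega q h hq (x q h) = y q h := OmegaHom_x ..

theorem Omega_y (hq : q = -1) : Omega q h hq (y q h) = x q h := OmegaHom_y ..

theorem Omega_t (hq : q = -1) : Omega q h hq (t q h) = -t q h := OmegaHom_t ..

end QuantumGWA

end QuantumGWA

/-! The algebra `W` is ℤ-graded with `x` in degree 1, `y` in degree -1 and `k[t]` in degree 0, and
every element is uniquely a sum of terms `r * gen n`. The main step is to show that an automorphism
φ scales `t`.

For this, set `t = 0` and send `x` to αT and `y` to βT⁻¹ with αβ = h(0). This maps `W` to Laurent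
polynomials, and for α = 1 or β = 1 the image contains T or T⁻¹, which is not algebraic over `k`. A
map to a commutative domain that does not kill `t` must kill `x` and `y`, because q ≠ 1; it then
sends `t` to a root of `h`, so its image is algebraic. Composing with φ, these maps kill φ(t), so
φ(t) lies in tW (`map_t_eq_t_mul`). The same holds for φ⁻¹, so the cofactor is a unit; units have
degree 0 because `h` is not a unit, so the cofactor is a constant γ (`exists_map_t_eq_smul`).

Now φ(x)φ(y) = h(γt) is a nonzero element of `k[t]`, so both factors are homogeneous, of degrees n
and -n. Comparison with φ⁻¹ gives n = ±1 (`map_x_degree`). If n = 1, the relation xy = h puts φ in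
`G` (`mem_G_of_map_x_mem`). If n = -1, the relation xt = qtx forces q² = 1
(`sq_eq_one_of_map_x_mem`). For q = -1, Ω exchanges the two cases, so `G` has index two. -/

namespace AddMonoidAlgebra

/-! ### Factorizations of degree zero elements in a group algebra of ℤ. -/

theorem support_eq_of_mul_eq_single_zero {A : Type*} [Semiring A] {F G : AddMonoidAlgebra A ℤ}
    {c : A} (hc : c ≠ 0) (hFG : F * G = single 0 c)
    (hne : ∀ i ∈ F.coeff.support, ∀ j ∈ G.coeff.support, F.coeff i * G.coeff j ≠ 0) :
    ∃ n : ℤ, F.coeff.support = {n} ∧ G.coeff.support = {-n} := by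
  classical
  have hs : single (0 : ℤ) c ≠ 0 := by
    intro h0
    have := congrArg (fun z => z.coeff 0) h0
    simp at this
    exact hc this
  have hF : F.coeff.support.Nonempty := by
    rw [Finset.nonempty_iff_ne_empty]
    intro h0
    have : F = 0 := by simpa using h0
    simp only [this, zero_mul] at hFG
    exact hs hFG.symm
  have hG : G.coeff.support.Nonempty := by
    rw [Finset.nonempty_iff_ne_empty]
    intro h0
    have : G = 0 := by simpa using h0
    simp only [this, mul_zero] at hFG
    exact hs hFG.symm
  -- A degree i + j reached by only one pair carries a single nonzero product, so it must be 0. Both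
  -- the pair of maxima and the pair of minima are such, and the two equations force max = min in
  -- each support.
  have key : ∀ i ∈ F.coeff.support, ∀ j ∈ G.coeff.support,
      UniqueAdd F.coeff.support G.coeff.support i j → i + j = 0 := by
    intro i hi j hj hu
    by_contra hij
    have h1 := coeff_mul_add_of_uniqueAdd hu
    rw [hFG, coeff_single, Finsupp.single_apply, if_neg (Ne.symm hij)] at h1
    exact hne i hi j hj h1.symm
  have hmax := key _ (F.coeff.support.max'_mem hF) _ (G.coeff.support.max'_mem hG) (by
    intro a b ha hb hab
    have := F.coeff.support.le_max' a ha
    have := G.coeff.support.le_max' b hb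
    omega)
  have hmin := key _ (F.coeff.support.min'_mem hF) _ (G.coeff.support.min'_mem hG) (by
    intro a b ha hb hab
    have := F.coeff.support.min'_le a ha
    have := G.coeff.support.min'_le b hb
    omega)
  have h1 := F.coeff.support.min'_le _ (F.coeff.support.max'_mem hF)
  have h2 := G.coeff.support.min'_le _ (G.coeff.support.max'_mem hG)
  refine ⟨F.coeff.support.max' hF, ?_, ?_⟩
  · refine Finset.eq_singleton_iff_unique_mem.2 ⟨F.coeff.support.max'_mem hF, fun a ha => ?_⟩
    have := F.coeff.support.le_max' a ha
    have := F.coeff.support.min'_le a ha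
    omega
  · have hj := G.coeff.support.max'_mem hG
    rw [Finset.eq_singleton_iff_unique_mem]
    constructor
    · convert hj using 1
      omega
    · intro a ha
      have := G.coeff.support.le_max' a ha
      have := G.coeff.support.min'_le a ha
      omega

end AddMonoidAlgebra

/-! ### The grading and the normal form. -/

namespace GWA

section Graded

variable {k : Type u} {R : Type v} [Field k] [CommRing R] [Algebra k R]
  (σ : R ≃ₐ[k] R) (h : R)

/-- The monomial of degree `n`: a power of `x` if `0 ≤ n`, a power of `y` otherwise. -/
def gen : ℤ → GWA σ h
  | Int.ofNat n => x σ h ^ n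
  | Int.negSucc n => y σ h ^ (n + 1)

theorem gen_natCast (n : ℕ) : gen σ h n = x σ h ^ n := rfl

theorem gen_negSucc (n : ℕ) : gen σ h (Int.negSucc n) = y σ h ^ (n + 1) := rfl

theorem gen_neg_natCast (n : ℕ) : gen σ h (-n) = y σ h ^ n := by
  cases n with
  | zero => simp [show gen σ h 0 = x σ h ^ 0 from rfl]
  | succ n => rfl

theorem gen_zero : gen σ h 0 = 1 := pow_zero _

theorem gen_one : gen σ h 1 = x σ h := pow_one _

theorem gen_neg_one : gen σ h (-1) = y σ h := pow_one _

/-- The `k`-subspace of elements of degree `n`. -/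
def homogeneous (n : ℤ) : Submodule k (GWA σ h) :=
  LinearMap.range ((LinearMap.mulRight k (gen σ h n)).comp (base σ h).toLinearMap)

variable {σ h}

theorem mem_homogeneous {n : ℤ} {w : GWA σ h} :
    w ∈ homogeneous σ h n ↔ ∃ r, base σ h r * gen σ h n = w := Iff.rfl

theorem base_mul_mem {n : ℤ} (r : R) {w : GWA σ h} (hw : w ∈ homogeneous σ h n) :
    base σ h r * w ∈ homogeneous σ h n := by
  obtain ⟨s, rfl⟩ := mem_homogeneous.1 hw
  exact mem_homogeneous.2 ⟨r * s, by rw [map_mul, mul_assoc]⟩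

theorem gen_mem (n : ℤ) : gen σ h n ∈ homogeneous σ h n :=
  mem_homogeneous.2 ⟨1, by simp⟩

theorem base_mem (r : R) : base σ h r ∈ homogeneous σ h 0 :=
  mem_homogeneous.2 ⟨r, by rw [gen_zero, mul_one]⟩

theorem x_mul_mem {n : ℤ} {w : GWA σ h} (hw : w ∈ homogeneous σ h n) :
    x σ h * w ∈ homogeneous σ h (n + 1) := by
  obtain ⟨s, rfl⟩ := mem_homogeneous.1 hw
  rw [← mul_assoc, x_mul_base, mul_assoc]
  refine base_mul_mem _ ?_
  rcases n with n | n
  · have := gen_mem (σ := σ) (h := h) ((n + 1 : ℕ) : ℤ)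
    rw [gen_natCast, pow_succ'] at this
    exact this
  · rw [gen_negSucc, pow_succ', ← mul_assoc, x_mul_y, ← gen_neg_natCast]
    have : Int.negSucc n + 1 = -(n : ℤ) := by omega
    rw [this]
    exact base_mul_mem _ (gen_mem _)

theorem y_mul_mem {n : ℤ} {w : GWA σ h} (hw : w ∈ homogeneous σ h n) :
    y σ h * w ∈ homogeneous σ h (n - 1) := by
  obtain ⟨s, rfl⟩ := mem_homogeneous.1 hw
  rw [← mul_assoc, y_mul_base, mul_assoc]
  refine base_mul_mem _ ?_
  obtain ⟨m, rfl | rfl⟩ : ∃ m : ℕ, n = (m + 1 : ℕ) ∨ n = -m := by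
    rcases n with (_ | n) | n
    · exact ⟨0, Or.inr rfl⟩
    · exact ⟨n, Or.inl rfl⟩
    · exact ⟨n + 1, Or.inr rfl⟩
  · rw [gen_natCast, pow_succ', ← mul_assoc, y_mul_x, ← gen_natCast]
    have : ((m + 1 : ℕ) : ℤ) - 1 = m := by omega
    rw [this]
    exact base_mul_mem _ (gen_mem _)
  · have := gen_mem (σ := σ) (h := h) (-((m + 1 : ℕ) : ℤ))
    rw [gen_neg_natCast, pow_succ', ← gen_neg_natCast] at this
    convert this using 2
    push_cast
    ring

theorem mul_mem_homogeneous {m n : ℤ} {v w : GWA σ h} (hv : v ∈ homogeneous σ h m)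
    (hw : w ∈ homogeneous σ h n) : v * w ∈ homogeneous σ h (m + n) := by
  obtain ⟨s, rfl⟩ := mem_homogeneous.1 hv
  rw [mul_assoc]
  refine base_mul_mem _ ?_
  clear hv
  rcases m.eq_nat_or_neg with ⟨m, rfl | rfl⟩
  · rw [gen_natCast]
    induction m with
    | zero => simpa using hw
    | succ m ih =>
      rw [pow_succ', mul_assoc]
      convert x_mul_mem ih using 2
      push_cast
      ring
  · rw [gen_neg_natCast]
    induction m with
    | zero => simpa using hw
    | succ m ih =>
      rw [pow_succ', mul_assoc]
      convert y_mul_mem ih using 2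
      push_cast
      ring

instance : SetLike.GradedMonoid (homogeneous σ h) where
  one_mem := by simpa using base_mem (σ := σ) (h := h) 1
  mul_mem _ _ _ _ := mul_mem_homogeneous

/-- The universal property gives a map into `S`; followed by the inclusion it fixes the generators,
so it is the identity. -/
theorem mem_of_generators (S : Subalgebra k (GWA σ h)) (hb : ∀ r, base σ h r ∈ S)
    (hx : x σ h ∈ S) (hy : y σ h ∈ S) (w : GWA σ h) : w ∈ S := by
  let f : GWA σ h →ₐ[k] S := lift σ h ((base σ h).codRestrict S hb) ⟨x σ h, hx⟩ ⟨y σ h, hy⟩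
    (Subtype.ext (x_mul_y σ h)) (Subtype.ext (y_mul_x σ h))
    (fun r => Subtype.ext (x_mul_base σ h r)) (fun r => Subtype.ext (y_mul_base σ h r))
  have hf : S.val.comp f = AlgHom.id k _ := by
    refine hom_ext σ h (fun r => ?_) ?_ ?_ <;> simp [f, lift_base, lift_x, lift_y]
  have := DFunLike.congr_fun hf w
  rw [← AlgHom.id_apply (R := k) w, ← this]
  exact (f w).2

variable (σ h) in
/-- The element `∑ fₙ eₙ`, where `eₙ` is the monomial of degree `n`. -/
noncomputable def ofFinsupp : (ℤ →₀ R) →ₗ[k] GWA σ h :=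
  Finsupp.lsum k fun n => (LinearMap.mulRight k (gen σ h n)).comp (base σ h).toLinearMap

theorem ofFinsupp_single (n : ℤ) (r : R) :
    ofFinsupp σ h (Finsupp.single n r) = base σ h r * gen σ h n := by
  simp [ofFinsupp]

theorem homogeneous_le_range (n : ℤ) :
    homogeneous σ h n ≤ LinearMap.range (ofFinsupp σ h) := by
  intro w hw
  obtain ⟨r, rfl⟩ := mem_homogeneous.1 hw
  exact ⟨_, ofFinsupp_single n r⟩

theorem mul_mem_range_ofFinsupp {m : ℤ} {v w : GWA σ h} (hv : v ∈ homogeneous σ h m)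
    (hw : w ∈ LinearMap.range (ofFinsupp σ h)) :
    v * w ∈ LinearMap.range (ofFinsupp σ h) := by
  obtain ⟨f, rfl⟩ := hw
  induction f using Finsupp.induction_linear with
  | zero => simp
  | add f g hf hg =>
    rw [map_add, mul_add]
    exact add_mem hf hg
  | single n r =>
    rw [ofFinsupp_single]
    exact homogeneous_le_range _ (mul_mem_homogeneous hv (base_mul_mem _ (gen_mem _)))

/-- The elements whose left multiplication preserves the range form a subalgebra containing the
generators, and 1 lies in the range. -/
theorem ofFinsupp_surjective : Function.Surjective (ofFinsupp σ h) := by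
  let S : Subalgebra k (GWA σ h) :=
    { carrier := {v | ∀ w ∈ LinearMap.range (ofFinsupp σ h),
        v * w ∈ LinearMap.range (ofFinsupp σ h)}
      mul_mem' := fun {a b} ha hb w hw => by
        rw [mul_assoc]
        exact ha _ (hb _ hw)
      add_mem' := fun {a b} ha hb w hw => by
        rw [add_mul]
        exact add_mem (ha _ hw) (hb _ hw)
      algebraMap_mem' := fun c w hw => by
        rw [← Algebra.smul_def]
        exact Submodule.smul_mem _ _ hw }
  intro w
  have hw : w ∈ S := mem_of_generators S
    (fun r w hw => mul_mem_range_ofFinsupp (base_mem r) hw)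
    (fun w hw => mul_mem_range_ofFinsupp (gen_one σ h ▸ gen_mem 1) hw)
    (fun w hw => mul_mem_range_ofFinsupp (gen_neg_one σ h ▸ gen_mem (-1)) hw) w
  have h1 : (1 : GWA σ h) ∈ LinearMap.range (ofFinsupp σ h) :=
    homogeneous_le_range 0 (by simpa using base_mem (σ := σ) (h := h) 1)
  simpa using hw 1 h1

theorem base_mul_ofFinsupp (r : R) (f : ℤ →₀ R) :
    base σ h r * ofFinsupp σ h f = ofFinsupp σ h (r • f) := by
  induction f using Finsupp.induction_linear with
  | zero => simp
  | add f g hf hg => rw [map_add, mul_add, hf, hg, smul_add, map_add]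
  | single n s =>
    rw [ofFinsupp_single, Finsupp.smul_single, ofFinsupp_single, smul_eq_mul, map_mul, mul_assoc]

/-! ### The coaction of ℤ and the representation on `R`. -/

section Coaction

variable {A : Type w} [Ring A] [Algebra k A] (Φ : GWA σ h →ₐ[k] A)

/-- The homomorphism into `A[ℤ]` that sends `w` of degree `n` to `Φ w` in degree `n`. -/
noncomputable def gradedHom : GWA σ h →ₐ[k] AddMonoidAlgebra A ℤ :=
  lift σ h (AddMonoidAlgebra.singleZeroAlgHom.comp (Φ.comp (base σ h)))
    (AddMonoidAlgebra.single 1 (Φ (x σ h))) (AddMonoidAlgebra.single (-1) (Φ (y σ h)))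
    (by
      change _ = AddMonoidAlgebra.single 0 _
      rw [AddMonoidAlgebra.single_mul_single, ← map_mul, x_mul_y]
      rfl)
    (by
      change _ = AddMonoidAlgebra.single 0 _
      rw [AddMonoidAlgebra.single_mul_single, ← map_mul, y_mul_x]
      rfl)
    (by
      intro r
      change _ * AddMonoidAlgebra.single 0 (Φ (base σ h r)) =
        AddMonoidAlgebra.single 0 (Φ (base σ h (σ r))) * _
      rw [AddMonoidAlgebra.single_mul_single, AddMonoidAlgebra.single_mul_single, ← map_mul,
        ← map_mul, x_mul_base, add_comm])
    (by
      intro r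
      change _ * AddMonoidAlgebra.single 0 (Φ (base σ h r)) =
        AddMonoidAlgebra.single 0 (Φ (base σ h (σ.symm r))) * _
      rw [AddMonoidAlgebra.single_mul_single, AddMonoidAlgebra.single_mul_single, ← map_mul,
        ← map_mul, y_mul_base, add_comm])

theorem gradedHom_base (r : R) :
    gradedHom Φ (base σ h r) = AddMonoidAlgebra.single 0 (Φ (base σ h r)) := by
  simp [gradedHom, lift_base]

theorem gradedHom_gen (n : ℤ) :
    gradedHom Φ (gen σ h n) = AddMonoidAlgebra.single n (Φ (gen σ h n)) := by
  rcases n.eq_nat_or_neg with ⟨n, rfl | rfl⟩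
  · rw [gen_natCast, map_pow, map_pow, gradedHom, lift_x, AddMonoidAlgebra.single_pow]
    simp
  · rw [gen_neg_natCast, map_pow, map_pow, gradedHom, lift_y, AddMonoidAlgebra.single_pow]
    simp

theorem coeff_gradedHom_ofFinsupp (f : ℤ →₀ R) (n : ℤ) :
    (gradedHom Φ (ofFinsupp σ h f)).coeff n = Φ (base σ h (f n) * gen σ h n) := by
  induction f using Finsupp.induction_linear with
  | zero => simp
  | add f g hf hg => simp [hf, hg, add_mul]
  | single m r =>
    rw [ofFinsupp_single, map_mul, gradedHom_base, gradedHom_gen,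
      AddMonoidAlgebra.single_mul_single, zero_add, ← map_mul, AddMonoidAlgebra.coeff_single,
      Finsupp.single_apply, Finsupp.single_apply]
    split_ifs with hmn
    · rw [hmn]
    · simp

end Coaction

variable (σ h) in
/-- The action on `R` in which `R` acts by multiplication, `x` as `σ` and `y` as `σ⁻¹ h`. -/
def toEnd : GWA σ h →ₐ[k] Module.End k R :=
  lift σ h (Algebra.lmul k R) σ.toLinearMap (σ.symm.toLinearMap * LinearMap.mulLeft k h)
    (by ext; simp) (by ext; simp) (by intro r; ext; simp)
    (by intro r; ext; simp [mul_left_comm])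

/-- Over a domain, `x` acts by an automorphism, `y` by multiplication by `h ≠ 0` followed by an
automorphism, and `r` by multiplication. -/
theorem toEnd_injective [IsDomain R] (hh : h ≠ 0) {r : R} (hr : r ≠ 0) (n : ℤ) :
    Function.Injective (toEnd σ h (base σ h r * gen σ h n)) := by
  have hx : Function.Injective (toEnd σ h (x σ h)) := by
    rw [toEnd, lift_x]
    exact σ.injective
  have hy : Function.Injective (toEnd σ h (y σ h)) := by
    rw [toEnd, lift_y]
    exact σ.symm.injective.comp (mul_right_injective₀ hh)
  have hb : Function.Injective (toEnd σ h (base σ h r)) := by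
    rw [toEnd, lift_base]
    exact mul_right_injective₀ hr
  rw [map_mul]
  refine hb.comp ?_
  rcases n.eq_nat_or_neg with ⟨n, rfl | rfl⟩
  · rw [gen_natCast, map_pow, Module.End.coe_pow]
    exact hx.iterate n
  · rw [gen_neg_natCast, map_pow, Module.End.coe_pow]
    exact hy.iterate n

/-! ### Uniqueness of the normal form, factors of base elements, units. -/

section Domain

variable [IsDomain R] (hh : h ≠ 0)
include hh

theorem toEnd_eq_zero_iff (r : R) (n : ℤ) :
    toEnd σ h (base σ h r * gen σ h n) = 0 ↔ r = 0 := by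
  refine ⟨fun h0 => ?_, fun h0 => by simp [h0]⟩
  by_contra hr
  have := toEnd_injective (σ := σ) hh hr n
  rw [h0] at this
  exact one_ne_zero (this (a₁ := 1) (a₂ := 0) rfl)

theorem base_mul_gen_inj {r s : R} {n : ℤ}
    (hrs : base σ h r * gen σ h n = base σ h s * gen σ h n) : r = s := by
  rw [← sub_eq_zero, ← toEnd_eq_zero_iff (σ := σ) hh (r - s) n, map_sub, sub_mul, hrs, sub_self,
    map_zero]

theorem base_injective : Function.Injective (base σ h) := fun r s hrs =>
  base_mul_gen_inj hh (n := 0) (by rw [hrs])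

theorem support_gradedHom_toEnd (f : ℤ →₀ R) :
    (gradedHom (toEnd σ h) (ofFinsupp σ h f)).coeff.support = f.support := by
  ext n
  rw [Finsupp.mem_support_iff, coeff_gradedHom_ofFinsupp, Ne, toEnd_eq_zero_iff hh,
    Finsupp.mem_support_iff]

/-- The coaction is needed because `toEnd` alone can merge degrees: if σ has finite order N, then xᴺ
and 1 act alike. -/
theorem ofFinsupp_injective : Function.Injective (ofFinsupp σ h) := by
  rw [injective_iff_map_eq_zero]
  intro f hf
  rw [← Finsupp.support_eq_empty, ← support_gradedHom_toEnd (σ := σ) hh, hf]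
  simp

theorem base_mul_eq_zero {r : R} (hr : r ≠ 0) {w : GWA σ h} (hw : base σ h r * w = 0) :
    w = 0 := by
  obtain ⟨f, rfl⟩ := ofFinsupp_surjective w
  rw [base_mul_ofFinsupp, map_eq_zero_iff _ (ofFinsupp_injective hh)] at hw
  rw [(smul_eq_zero.1 hw).resolve_left hr, map_zero]

theorem eq_of_homogeneous {m n : ℤ} {w : GWA σ h} (hw : w ≠ 0) (hm : w ∈ homogeneous σ h m)
    (hn : w ∈ homogeneous σ h n) : m = n := by
  obtain ⟨r, rfl⟩ := mem_homogeneous.1 hm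
  obtain ⟨s, hs⟩ := mem_homogeneous.1 hn
  rw [← ofFinsupp_single, ← ofFinsupp_single] at hs
  rcases (Finsupp.single_eq_single_iff _ _ _ _).1 (ofFinsupp_injective hh hs) with h1 | h1
  · exact h1.1.symm
  · simp [h1.2] at hw

/-- If a product is a nonzero element of `R`, then both factors are homogeneous. -/
theorem homogeneous_of_mul_eq_base {v w : GWA σ h} {r : R} (hr : r ≠ 0)
    (hvw : v * w = base σ h r) :
    ∃ n : ℤ, v ∈ homogeneous σ h n ∧ w ∈ homogeneous σ h (-n) := by
  obtain ⟨f, rfl⟩ := ofFinsupp_surjective v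
  obtain ⟨g, rfl⟩ := ofFinsupp_surjective w
  -- In the group algebra over `Module.End k R`, every nonzero coefficient acts injectively, so
  -- products of coefficients cannot vanish even though the coefficient ring may have zero divisors.
  have h1 := congrArg (gradedHom (toEnd σ h)) hvw
  rw [map_mul, gradedHom_base] at h1
  obtain ⟨n, hf, hg⟩ := AddMonoidAlgebra.support_eq_of_mul_eq_single_zero
    (by
      have := (toEnd_eq_zero_iff (σ := σ) hh r 0).not.2 hr
      rwa [gen_zero, mul_one] at this) h1 (by
    intro i hi j hj
    rw [support_gradedHom_toEnd hh, Finsupp.mem_support_iff] at hi hj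
    rw [coeff_gradedHom_ofFinsupp, coeff_gradedHom_ofFinsupp]
    have hinj := (toEnd_injective (σ := σ) hh hi i).comp (toEnd_injective (σ := σ) hh hj j)
    intro h0
    rw [← Module.End.coe_mul, h0] at hinj
    exact one_ne_zero (hinj (a₁ := 1) (a₂ := 0) rfl))
  rw [support_gradedHom_toEnd hh] at hf hg
  rw [(Finsupp.support_eq_singleton.1 hf).2, (Finsupp.support_eq_singleton.1 hg).2,
    ofFinsupp_single, ofFinsupp_single]
  exact ⟨n, base_mul_mem _ (gen_mem _), base_mul_mem _ (gen_mem _)⟩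

/-- If `h` is not a unit, then every unit has degree `0`. -/
theorem homogeneous_zero_of_mul_eq_one (hu : ¬IsUnit h) {v w : GWA σ h} (hvw : v * w = 1) :
    v ∈ homogeneous σ h 0 ∧ w ∈ homogeneous σ h 0 := by
  -- Everything in the image is a multiple of σ⁻¹(h), so reaching 1 would make `h` a unit.
  have hneg : ∀ (m : ℕ) (b : R), ¬Function.Surjective
      (toEnd σ h (base σ h b * gen σ h (Int.negSucc m))) := by
    intro m b hs
    obtain ⟨f, hf⟩ := hs 1
    rw [gen_negSucc, pow_succ', map_mul, map_mul, Module.End.mul_apply, Module.End.mul_apply,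
      toEnd, lift_base, lift_y] at hf
    simp only [Algebra.coe_lmul_eq_mul, LinearMap.mul_apply', Module.End.mul_apply,
      AlgEquiv.toLinearMap_apply, LinearMap.mulLeft_apply, map_mul] at hf
    rw [mul_left_comm] at hf
    have := IsUnit.of_mul_eq_one _ hf
    exact hu (by simpa using this.map σ)
  have hne : v ≠ 0 ∧ w ≠ 0 := by
    have h1 : (1 : GWA σ h) ≠ 0 := by
      intro h0
      rw [← map_one (base σ h), ← map_zero (base σ h)] at h0
      exact one_ne_zero (base_injective hh h0)
    constructor <;> rintro rfl <;> simp at hvw <;> exact h1 hvw.symm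
  obtain ⟨n, hv, hw⟩ := homogeneous_of_mul_eq_base (σ := σ) hh (one_ne_zero (α := R))
    (by rw [hvw, map_one])
  have hcomp : ∀ f, toEnd σ h v (toEnd σ h w f) = f := fun f => by
    rw [← Module.End.mul_apply, ← map_mul, hvw, map_one, Module.End.one_apply]
  have hinj : Function.Injective (toEnd σ h v) := by
    obtain ⟨a, rfl⟩ := mem_homogeneous.1 hv
    exact toEnd_injective hh (by rintro rfl; simp at hne) n
  -- Since vw = 1, `v` acts surjectively; it also acts injectively, so `w` is onto as well.
  -- Whichever of the two has negative degree contradicts `hneg`.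
  rcases n with (_ | n) | n
  · exact ⟨hv, by simpa using hw⟩
  · obtain ⟨b, rfl⟩ := mem_homogeneous.1 hw
    exact absurd (fun f => ⟨_, hinj (hcomp (toEnd σ h v f))⟩) (hneg n b)
  · obtain ⟨a, rfl⟩ := mem_homogeneous.1 hv
    exact absurd (fun f => ⟨_, hcomp f⟩) (hneg n a)

end Domain

end Graded

end GWA

/-! ### Characters of `W` and maps to commutative domains. -/

namespace QuantumGWA

variable {k : Type u} [Field k] {q : kˣ} {h : k[X]}

theorem base_C_mul (c : k) (r : k[X]) :
    GWA.base (scaleAut q) h (C c * r) = c • GWA.base (scaleAut q) h r := by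
  rw [← smul_eq_C_mul, map_smul]

theorem gen_one : GWA.gen (scaleAut q) h 1 = x q h := GWA.gen_one _ _

theorem gen_neg_one : GWA.gen (scaleAut q) h (-1) = y q h := GWA.gen_neg_one _ _

theorem x_mem : x q h ∈ GWA.homogeneous (scaleAut q) h 1 := gen_one (q := q) ▸ GWA.gen_mem 1

theorem y_mem : y q h ∈ GWA.homogeneous (scaleAut q) h (-1) :=
  gen_neg_one (q := q) ▸ GWA.gen_mem (-1)

theorem x_mul_y : x q h * y q h = GWA.base (scaleAut q) h h := GWA.x_mul_y _ _

theorem x_mul_t : x q h * t q h = (q : k) • (t q h * x q h) := by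
  rw [GWA.x_mul_base, scaleAut_X, base_C_mul, smul_mul_assoc]

theorem y_mul_t : y q h * t q h = ((q⁻¹ : kˣ) : k) • (t q h * y q h) := by
  rw [GWA.y_mul_base, scaleAut_symm, scaleAut_X, base_C_mul, smul_mul_assoc]

/-- The character of `W` with `x ↦ α`, `y ↦ β`, `t ↦ 0`, where `α β = h(0)`. -/
noncomputable def character (α β : k) (hαβ : α * β = h.coeff 0) : QuantumGWA q h →ₐ[k] k :=
  GWA.lift (scaleAut q) h (aeval 0) α β
    (by rw [hαβ, coeff_zero_eq_aeval_zero])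
    (by rw [mul_comm, hαβ, ← coeff_zero_eq_aeval_zero, scaleAut_symm, scaleAut_coeff]; simp)
    (by
      intro r
      rw [← coeff_zero_eq_aeval_zero, ← coeff_zero_eq_aeval_zero, scaleAut_coeff]
      simp [mul_comm])
    (by
      intro r
      rw [← coeff_zero_eq_aeval_zero, ← coeff_zero_eq_aeval_zero, scaleAut_symm, scaleAut_coeff]
      simp [mul_comm])

section character

variable (α β : k) (hαβ : α * β = h.coeff 0)

theorem character_base (r : k[X]) :
    character (q := q) α β hαβ (GWA.base (scaleAut q) h r) = r.coeff 0 := by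
  rw [character, GWA.lift_base, coeff_zero_eq_aeval_zero]

theorem character_x : character (q := q) α β hαβ (x q h) = α := GWA.lift_x ..

theorem character_y : character (q := q) α β hαβ (y q h) = β := GWA.lift_y ..

end character

/-- A homomorphism to a commutative domain that does not kill `t` has algebraic image. -/
theorem isIntegral_of_map_t_ne_zero {L : Type*} [CommRing L] [IsDomain L] [Algebra k L]
    (hq : q ≠ 1) (hh : h ≠ 0) (ψ : QuantumGWA q h →ₐ[k] L) (ht : ψ (t q h) ≠ 0)
    (w : QuantumGWA q h) : IsIntegral k (ψ w) := by
  -- In a commutative target the relation reads (p - 1)τz = 0, where τ is the image of `t`.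
  have aux : ∀ (p : kˣ), p ≠ 1 → ∀ z : L, z * ψ (t q h) = (p : k) • (ψ (t q h) * z) → z = 0 := by
    intro p hp z hz
    have h1 : ((p : k) - 1) • (ψ (t q h) * z) = 0 := by
      rw [sub_smul, ← hz, one_smul, mul_comm, sub_self]
    have h2 : (p : k) - 1 ≠ 0 := by
      rw [sub_ne_zero]
      exact fun h0 => hp (Units.ext h0)
    have h3 : ψ (t q h) * z = 0 := by
      have := congrArg (fun y => ((p : k) - 1)⁻¹ • y) h1
      simpa only [smul_smul, inv_mul_cancel₀ h2, one_smul, smul_zero] using this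
    exact (mul_eq_zero.1 h3).resolve_left ht
  have hx : ψ (x q h) = 0 := aux q hq _ (by
    rw [← map_mul, x_mul_t, map_smul, map_mul])
  have hy : ψ (y q h) = 0 := aux q⁻¹ (by simpa using hq) _ (by
    rw [← map_mul, y_mul_t, map_smul, map_mul])
  have hbase : ∀ r, ψ (GWA.base (scaleAut q) h r) = aeval (ψ (t q h)) r := by
    intro r
    have : ψ.comp (GWA.base (scaleAut q) h) = aeval (ψ (t q h)) := by
      ext
      simp
    exact DFunLike.congr_fun this r
  have hτ : IsIntegral k (ψ (t q h)) := by
    rw [← isAlgebraic_iff_isIntegral]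
    -- The image of `t` is a root of `h`, since xy = h and `x` is killed.
    refine ⟨h, hh, ?_⟩
    rw [← hbase, ← x_mul_y, map_mul, hx, zero_mul]
  refine GWA.mem_of_generators ((integralClosure k L).comap ψ) (fun r => ?_) ?_ ?_ w
  · change ψ _ ∈ integralClosure k L
    rw [hbase]
    exact Algebra.adjoin_le (S := integralClosure k L) (Set.singleton_subset_iff.2 hτ)
      (aeval_mem_adjoin_singleton _ _)
  · change ψ _ ∈ integralClosure k L
    rw [hx]
    exact zero_mem _
  · change ψ _ ∈ integralClosure k L
    rw [hy]
    exact zero_mem _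

theorem not_isIntegral_T_one : ¬IsIntegral k (LaurentPolynomial.T 1 : LaurentPolynomial k) := by
  rw [← isAlgebraic_iff_isIntegral]
  rintro ⟨p, hp, h0⟩
  have h1 : (aeval (LaurentPolynomial.T 1 : LaurentPolynomial k)) = (toLaurentAlg (R := k)) := by
    ext
    simp
  rw [h1, toLaurentAlg_apply, toLaurent_eq_zero] at h0
  exact hp h0

/-! ### Shape of an arbitrary automorphism. -/

section Automorphism

variable (φ : QuantumGWA q h ≃ₐ[k] QuantumGWA q h)

/-- Otherwise the composite with φ would have algebraic image. As φ is onto, that image contains T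
(if α = 1) or T⁻¹ (if β = 1). -/
theorem gradedHom_character_map_t (hq : q ≠ 1) (hh : h ≠ 0) (α β : k)
    (hαβ : α * β = h.coeff 0) (h1 : α = 1 ∨ β = 1) :
    GWA.gradedHom (character α β hαβ) (φ (t q h)) = 0 := by
  by_contra h0
  have key := isIntegral_of_map_t_ne_zero hq hh
    ((GWA.gradedHom (character α β hαβ)).comp (φ : QuantumGWA q h →ₐ[k] QuantumGWA q h)) h0
  rcases h1 with rfl | rfl
  · have this : IsIntegral k (GWA.gradedHom (character 1 β hαβ) (φ (φ.symm (x q h)))) := key _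
    rw [AlgEquiv.apply_symm_apply, ← gen_one, GWA.gradedHom_gen] at this
    rw [gen_one, character_x] at this
    exact not_isIntegral_T_one this
  · have this : IsIntegral k (GWA.gradedHom (character α 1 hαβ) (φ (φ.symm (y q h)))) := key _
    rw [AlgEquiv.apply_symm_apply, ← gen_neg_one, GWA.gradedHom_gen] at this
    rw [gen_neg_one, character_y] at this
    replace this : IsIntegral k (LaurentPolynomial.T (-1) : LaurentPolynomial k) := this
    have h2 := this.map (LaurentPolynomial.invert (R := k))
    rw [LaurentPolynomial.invert_T, neg_neg] at h2
    exact not_isIntegral_T_one h2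

theorem map_t_eq_t_mul (hq : q ≠ 1) (hh : h ≠ 0) : ∃ w, φ (t q h) = t q h * w := by
  obtain ⟨f, hf⟩ := GWA.ofFinsupp_surjective (φ (t q h))
  -- The coefficient in degree n is f n (0) times αⁿ or β⁻ⁿ. Taking α = 1 detects n ≥ 0 and β = 1
  -- detects n ≤ 0, even when h(0) = 0.
  have hcoeff : ∀ n, (f n).coeff 0 = 0 := by
    intro n
    rcases n.eq_nat_or_neg with ⟨n, rfl | rfl⟩
    · have := gradedHom_character_map_t φ hq hh 1 (h.coeff 0) (one_mul _) (Or.inl rfl)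
      have := congrArg (fun z => z.coeff (n : ℤ)) this
      simpa [← hf, GWA.coeff_gradedHom_ofFinsupp, character_base, GWA.gen_natCast,
        character_x] using this
    · have := gradedHom_character_map_t φ hq hh (h.coeff 0) 1 (mul_one _) (Or.inr rfl)
      have := congrArg (fun z => z.coeff (-n : ℤ)) this
      simpa [← hf, GWA.coeff_gradedHom_ofFinsupp, character_base, GWA.gen_neg_natCast,
        character_y] using this
  refine ⟨GWA.ofFinsupp (scaleAut q) h (f.mapRange divX (by simp)), ?_⟩
  rw [← hf, GWA.base_mul_ofFinsupp]
  congr 1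
  ext1 n
  rw [Finsupp.smul_apply, Finsupp.mapRange_apply, smul_eq_mul]
  conv_lhs => rw [← X_mul_divX_add (f n), hcoeff, C_0, add_zero]

theorem exists_map_t_eq_smul (hq : q ≠ 1) (hh : h ≠ 0) (hu : ¬IsUnit h) :
    ∃ γ : kˣ, φ (t q h) = (γ : k) • t q h := by
  obtain ⟨w, hw⟩ := map_t_eq_t_mul φ hq hh
  obtain ⟨w', hw'⟩ := map_t_eq_t_mul φ.symm hq hh
  -- Apply φ to φ⁻¹(t) = tw' and substitute φ(t) = tw.
  have h1 : t q h * (w * φ w' - 1) = 0 := by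
    rw [mul_sub, ← mul_assoc, ← hw, ← map_mul, ← hw', AlgEquiv.apply_symm_apply, mul_one,
      sub_self]
  have h2 : w * φ w' = 1 := sub_eq_zero.1 (GWA.base_mul_eq_zero hh X_ne_zero h1)
  obtain ⟨ha, hb⟩ := GWA.homogeneous_zero_of_mul_eq_one hh hu h2
  obtain ⟨a, rfl⟩ := GWA.mem_homogeneous.1 ha
  obtain ⟨b, hb⟩ := GWA.mem_homogeneous.1 hb
  rw [← hb, GWA.gen_zero, mul_one, mul_one, ← map_mul, ← map_one (GWA.base (scaleAut q) h)] at h2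
  have h3 := IsUnit.of_mul_eq_one _ (GWA.base_injective hh h2)
  obtain ⟨c, hc, rfl⟩ := isUnit_iff.1 h3
  refine ⟨hc.unit, ?_⟩
  rw [hw, GWA.gen_zero, mul_one, ← map_mul, mul_comm, base_C_mul]
  rfl

section ScaledT

variable {φ} {γ : kˣ} (hγ : φ (t q h) = (γ : k) • t q h)
include hγ

theorem map_base_of_map_t (r : k[X]) :
    φ (GWA.base (scaleAut q) h r) = GWA.base (scaleAut q) h (scaleAut γ r) := by
  have : (φ : QuantumGWA q h →ₐ[k] QuantumGWA q h).comp (GWA.base (scaleAut q) h) =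
      (GWA.base (scaleAut q) h).comp (scaleAut γ).toAlgHom := by
    ext
    simp [scaleAut_X, hγ, base_C_mul]
  exact DFunLike.congr_fun this r

theorem map_mem_homogeneous {n : ℤ} (hx : φ (x q h) ∈ GWA.homogeneous (scaleAut q) h n)
    (hy : φ (y q h) ∈ GWA.homogeneous (scaleAut q) h (-n)) {m : ℤ} {w : QuantumGWA q h}
    (hw : w ∈ GWA.homogeneous (scaleAut q) h m) :
    φ w ∈ GWA.homogeneous (scaleAut q) h (n * m) := by
  obtain ⟨r, rfl⟩ := GWA.mem_homogeneous.1 hw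
  rw [map_mul, map_base_of_map_t hγ]
  refine GWA.base_mul_mem _ ?_
  rcases m.eq_nat_or_neg with ⟨m, rfl | rfl⟩
  · rw [GWA.gen_natCast, map_pow]
    convert SetLike.pow_mem_graded m hx using 2
    simp [mul_comm]
  · rw [GWA.gen_neg_natCast, map_pow]
    convert SetLike.pow_mem_graded m hy using 2
    simp [mul_comm]

theorem exists_map_x_mem_homogeneous (hh : h ≠ 0) :
    ∃ n, φ (x q h) ∈ GWA.homogeneous (scaleAut q) h n ∧
      φ (y q h) ∈ GWA.homogeneous (scaleAut q) h (-n) := by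
  refine GWA.homogeneous_of_mul_eq_base hh (r := scaleAut γ h) (by simpa using hh) ?_
  rw [← map_mul, x_mul_y, map_base_of_map_t hγ]

theorem symm_map_t : φ.symm (t q h) = ((γ⁻¹ : kˣ) : k) • t q h := by
  rw [AlgEquiv.symm_apply_eq, map_smul, hγ, smul_smul]
  simp

end ScaledT

theorem x_ne_zero (hh : h ≠ 0) : x q h ≠ 0 := by
  intro h0
  have := (GWA.toEnd_eq_zero_iff (σ := scaleAut q) hh 1 1).1
    (by rw [map_one, one_mul, gen_one, h0, map_zero])
  exact one_ne_zero this

/-- Both φ and φ⁻¹ multiply degrees by integers, n and m; following `x` through φ⁻¹ and back gives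
nm = 1. -/
theorem map_x_degree (hq : q ≠ 1) (hh : h ≠ 0) (hu : ¬IsUnit h) :
    (φ (x q h) ∈ GWA.homogeneous (scaleAut q) h 1 ∧
      φ (y q h) ∈ GWA.homogeneous (scaleAut q) h (-1)) ∨
    (φ (x q h) ∈ GWA.homogeneous (scaleAut q) h (-1) ∧
      φ (y q h) ∈ GWA.homogeneous (scaleAut q) h 1) := by
  obtain ⟨γ, hγ⟩ := exists_map_t_eq_smul φ hq hh hu
  obtain ⟨n, hx, hy⟩ := exists_map_x_mem_homogeneous hγ hh
  obtain ⟨m, hx', -⟩ := exists_map_x_mem_homogeneous (symm_map_t hγ) hh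
  have h1 := map_mem_homogeneous hγ hx hy hx'
  rw [AlgEquiv.apply_symm_apply] at h1
  have h2 : n * m = 1 := GWA.eq_of_homogeneous hh (x_ne_zero hh) h1
    x_mem
  rcases Int.eq_one_or_neg_one_of_mul_eq_one h2 with rfl | rfl
  · exact Or.inl ⟨hx, hy⟩
  · exact Or.inr ⟨hx, hy⟩

/-- With φ(x) = ay, the image of xt = qtx says that `y` commutes past `t` with factor q, while the
actual factor is q⁻¹. -/
theorem sq_eq_one_of_map_x_mem (hq : q ≠ 1) (hh : h ≠ 0) (hu : ¬IsUnit h)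
    (hx : φ (x q h) ∈ GWA.homogeneous (scaleAut q) h (-1)) : q ^ 2 = 1 := by
  obtain ⟨γ, hγ⟩ := exists_map_t_eq_smul φ hq hh hu
  obtain ⟨a, ha⟩ := GWA.mem_homogeneous.1 hx
  have ha0 : a ≠ 0 := by
    rintro rfl
    rw [map_zero, zero_mul, eq_comm, map_eq_zero_iff _ φ.injective] at ha
    exact x_ne_zero hh ha
  have h1 := congrArg φ (x_mul_t (q := q) (h := h))
  rw [map_smul, map_mul, map_mul, hγ, ← ha, gen_neg_one, mul_smul_comm, smul_mul_assoc,
    smul_comm (q : k), mul_assoc, y_mul_t] at h1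
  have h2 := smul_right_injective _ γ.ne_zero h1
  rw [mul_smul_comm, ← mul_assoc, ← mul_assoc, ← map_mul, ← map_mul, ← smul_mul_assoc,
    ← smul_mul_assoc, ← map_smul, ← map_smul, ← gen_neg_one] at h2
  have h3 := GWA.base_mul_gen_inj (σ := scaleAut q) hh h2
  rw [mul_comm X a] at h3
  have h4 := smul_left_injective k (mul_ne_zero ha0 X_ne_zero) h3
  have h5 : q⁻¹ = q := Units.ext h4
  rw [sq]
  nth_rewrite 1 [← h5]
  exact inv_mul_cancel q

theorem mem_G_of_map_x_mem (hq : q ≠ 1) (hh : h ≠ 0) (hu : ¬IsUnit h)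
    (hx : φ (x q h) ∈ GWA.homogeneous (scaleAut q) h 1)
    (hy : φ (y q h) ∈ GWA.homogeneous (scaleAut q) h (-1)) : φ ∈ G q h := by
  obtain ⟨γ, hγ⟩ := exists_map_t_eq_smul φ hq hh hu
  obtain ⟨a, ha⟩ := GWA.mem_homogeneous.1 hx
  obtain ⟨b, hb⟩ := GWA.mem_homogeneous.1 hy
  rw [gen_one] at ha
  rw [gen_neg_one] at hb
  -- Here φ⁻¹(x) = a'x also has degree 1; applying φ exhibits an inverse of `a` in `k[t]`.
  obtain ⟨μ, rfl⟩ : ∃ μ : kˣ, a = C (μ : k) := by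
    obtain ⟨m, hx', -⟩ := exists_map_x_mem_homogeneous (symm_map_t hγ) hh
    have h1 := map_mem_homogeneous hγ hx hy hx'
    rw [AlgEquiv.apply_symm_apply, one_mul] at h1
    obtain rfl : m = 1 := GWA.eq_of_homogeneous hh (x_ne_zero hh) h1
      x_mem
    obtain ⟨a', ha'⟩ := GWA.mem_homogeneous.1 hx'
    have h2 := congrArg φ ha'
    rw [map_mul, map_base_of_map_t hγ, gen_one, AlgEquiv.apply_symm_apply, ← ha,
      ← mul_assoc, ← map_mul, ← gen_one] at h2
    have h3 : scaleAut γ a' * a = 1 :=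
      GWA.base_mul_gen_inj (σ := scaleAut q) hh (n := 1) (by rw [h2, map_one, one_mul])
    obtain ⟨c, hc, rfl⟩ := isUnit_iff.1 (IsUnit.of_mul_eq_one_right _ h3)
    exact ⟨hc.unit, rfl⟩
  have hφx : φ (x q h) = (μ : k) • x q h := by
    rw [← ha, ← mul_one (C _), base_C_mul, map_one, smul_mul_assoc, one_mul]
  -- This is φ applied to xy = h. Degrees make `b` a constant β; then γⁱ = μβ for every i in the
  -- support of `h`, so γ is killed by all gaps j - i and hence lies in `Cg h`.
  have h1 : C (μ : k) * (scaleAut q b * h) = scaleAut γ h := by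
    refine GWA.base_injective (σ := scaleAut q) hh ?_
    rw [← map_base_of_map_t hγ, ← x_mul_y, map_mul φ, hφx, ← hb, base_C_mul, smul_mul_assoc,
      ← mul_assoc, GWA.x_mul_base, mul_assoc, x_mul_y, map_mul]
  have hb0 : b ≠ 0 := by
    rintro rfl
    rw [map_zero, zero_mul, mul_zero, eq_comm] at h1
    exact hh (by simpa using h1)
  have hnat : ∀ (p : kˣ) (r : k[X]), (scaleAut p r).natDegree = r.natDegree := by
    intro p r
    have : (scaleAut p r).support = r.support := by
      ext n
      simp [scaleAut_coeff]
    exact natDegree_eq_of_degree_eq (by rw [degree, degree, this])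
  obtain ⟨β, rfl⟩ : ∃ β : k, b = C β := by
    have h2 := congrArg natDegree h1
    rw [natDegree_C_mul μ.ne_zero, natDegree_mul (by simpa using hb0) hh, hnat, hnat] at h2
    exact ⟨_, eq_C_of_natDegree_eq_zero (by omega)⟩
  have hC : scaleAut q (C β) = C β := (scaleAut q).commutes β
  have hcoeff : ∀ i ∈ h.support, (γ : k) ^ i = μ * β := by
    intro i hi
    have h2 := congrArg (fun p => coeff p i) h1
    simp only [hC, coeff_C_mul, scaleAut_coeff] at h2
    rw [← mul_assoc] at h2
    exact (mul_right_cancel₀ (mem_support_iff.1 hi) h2).symm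
  have hmem : γ ∈ Cg h := by
    rw [Cg, mem_rootsOfUnity, ← orderOf_dvd_iff_pow_eq_one]
    refine Finset.dvd_gcd fun p hp => ?_
    simp only [Finset.mem_filter, Finset.mem_product] at hp
    rw [orderOf_dvd_iff_pow_eq_one]
    have h2 : γ ^ p.1 = γ ^ p.2 := Units.ext (by
      push_cast
      rw [hcoeff _ hp.1.1, hcoeff _ hp.1.2])
    rw [pow_sub _ hp.2.le, h2, mul_inv_cancel]
  have hβ : β = ((μ⁻¹ * γ ^ h.natDegree : kˣ) : k) := by
    have := hcoeff _ (natDegree_mem_support_of_nonzero hh)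
    push_cast
    rw [this, inv_mul_cancel_left₀ μ.ne_zero]
  refine ⟨γ, μ, hmem, equiv_ext q h ?_ ?_ ?_⟩
  · rw [eta_x, hφx]
  · rw [eta_y, ← hb, ← hβ, ← mul_one (C _), base_C_mul, map_one, smul_mul_assoc, one_mul]
  · rw [eta_t, hγ]

end Automorphism

/-! ### The involution Ω and the semidirect product. -/

theorem Omega_mul_self (hq : q = -1) : Omega q h hq * Omega q h hq = 1 := by
  refine equiv_ext q h ?_ ?_ ?_ <;> simp [AlgEquiv.mul_apply, Omega_x, Omega_y, Omega_t]

theorem Omega_notMem_G (hh : h ≠ 0) (hq : q = -1) : Omega q h hq ∉ G q h := by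
  rintro ⟨γ, μ, hγ, h0⟩
  have h1 := DFunLike.congr_fun h0 (x q h)
  rw [Omega_x, eta_x] at h1
  have h2 := GWA.eq_of_homogeneous hh
    (by rw [h1]; exact smul_ne_zero μ.ne_zero (x_ne_zero hh)) y_mem
    (h1 ▸ Submodule.smul_mem _ _ x_mem)
  omega

theorem mem_G_or_mul_Omega_mem_G (hq1 : q ≠ 1) (hh : h ≠ 0) (hu : ¬IsUnit h) (hq : q = -1)
    (φ : QuantumGWA q h ≃ₐ[k] QuantumGWA q h) : φ ∈ G q h ∨ φ * Omega q h hq ∈ G q h := by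
  rcases map_x_degree φ hq1 hh hu with ⟨hx, hy⟩ | ⟨hx, hy⟩
  · exact Or.inl (mem_G_of_map_x_mem φ hq1 hh hu hx hy)
  · exact Or.inr (mem_G_of_map_x_mem _ hq1 hh hu
      (by rwa [AlgEquiv.mul_apply, Omega_x]) (by rwa [AlgEquiv.mul_apply, Omega_y]))

end QuantumGWA

namespace SemidirectProduct

/-- A subgroup of index two and an involution outside it form a semidirect product. -/
theorem exists_mulEquiv_of_involution {A : Type*} [Group A] (H : Subgroup A) (s : A)
    (hs : s * s = 1) (hsH : s ∉ H) (hcover : ∀ a, a ∈ H ∨ a * s ∈ H) :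
    ∃ (θ : Multiplicative (ZMod 2) →* MulAut H) (e : (H ⋊[θ] Multiplicative (ZMod 2)) ≃* A),
      (∀ a : H, e (SemidirectProduct.inl a) = a) ∧
        e (SemidirectProduct.inr (Multiplicative.ofAdd (1 : ZMod 2))) = s := by
  have hindex : H.index = 2 := by
    rw [Subgroup.index_eq_two_iff]
    refine ⟨s, fun b => ?_⟩
    by_cases hb : b ∈ H
    · refine Or.inr ⟨hb, fun h1 => hsH ?_⟩
      exact (Subgroup.mul_mem_cancel_left H hb).1 h1
    · exact Or.inl ⟨(hcover b).resolve_left hb, hb⟩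
  have : H.Normal := Subgroup.normal_of_index_eq_two hindex
  let ρ : Multiplicative (ZMod 2) →* A := AddMonoidHom.toMultiplicativeLeft
    (ZMod.lift 2 ⟨zmultiplesHom (Additive A) (Additive.ofMul s), by
      rw [Nat.cast_ofNat, zmultiplesHom_apply, ofNat_zsmul, two_nsmul, ← ofMul_mul, hs, ofMul_one]⟩)
  have hρ : ρ (Multiplicative.ofAdd 1) = s := by
    change Additive.toMul (ZMod.lift 2 _ ((1 : ℤ) : ZMod 2)) = s
    rw [ZMod.lift_coe]
    simp
  have hz : ∀ z : Multiplicative (ZMod 2), z = 1 ∨ z = Multiplicative.ofAdd 1 := by decide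
  have hF : ∀ z, H.subtype.comp ((MulAut.conjNormal.comp ρ) z).toMonoidHom =
      (MulAut.conj (ρ z)).toMonoidHom.comp H.subtype := by
    intro z
    ext a
    simp [MulAut.conjNormal_apply]
  -- This is (a, z) ↦ aρ(z), with action by conjugation. It is injective because s ∉ H, and onto
  -- because a = (as)s.
  let F := SemidirectProduct.lift (φ := MulAut.conjNormal.comp ρ) H.subtype ρ hF
  refine ⟨_, MulEquiv.ofBijective F ⟨?_, ?_⟩, fun a => ?_, ?_⟩
  · rw [injective_iff_map_eq_one]
    rintro ⟨a, z⟩ h0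
    have h1 : (a : A) * ρ z = 1 := h0
    rcases hz z with rfl | rfl
    · rw [map_one, mul_one] at h1
      exact SemidirectProduct.ext (Subtype.ext h1) rfl
    · rw [hρ] at h1
      exact absurd ((Subgroup.mul_mem_cancel_left H a.2).1 (h1 ▸ one_mem H)) hsH
  · intro a
    rcases hcover a with ha | ha
    · exact ⟨SemidirectProduct.inl ⟨a, ha⟩, SemidirectProduct.lift_inl _ _ hF _⟩
    · refine ⟨⟨⟨a * s, ha⟩, Multiplicative.ofAdd 1⟩, ?_⟩
      change a * s * ρ _ = a
      rw [hρ, mul_assoc, hs, mul_one]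
  · exact SemidirectProduct.lift_inl _ _ hF _
  · exact (SemidirectProduct.lift_inr _ _ hF _).trans hρ

end SemidirectProduct

theorem proposition6p1 {k : Type u} [Field k] (q : kˣ) (hq_root : IsOfFinOrder q)
    (hq_ne_one : q ≠ 1) (h : k[X]) (h_nonconst : ∀ c : k, h ≠ C c) :
    (q ^ 2 ≠ 1 → QuantumGWA.G q h = ⊤) ∧
    (∀ hq : q = -1,
      ∃ (θ : Multiplicative (ZMod 2) →* MulAut (QuantumGWA.G q h))
        (e : (QuantumGWA.G q h ⋊[θ] Multiplicative (ZMod 2)) ≃*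
          (QuantumGWA q h ≃ₐ[k] QuantumGWA q h)),
        (∀ φ : QuantumGWA.G q h, e (SemidirectProduct.inl φ) =
          (φ : QuantumGWA q h ≃ₐ[k] QuantumGWA q h)) ∧
        e (SemidirectProduct.inr (Multiplicative.ofAdd (1 : ZMod 2))) =
          QuantumGWA.Omega q h hq) := by
  have hh : h ≠ 0 := fun h0 => h_nonconst 0 (by rw [h0, C_0])
  have hu : ¬IsUnit h := by
    rw [isUnit_iff]
    rintro ⟨c, -, hc⟩
    exact h_nonconst c hc.symm
  refine ⟨fun hq2 => ?_, fun hq => ?_⟩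
  · rw [eq_top_iff]
    intro φ _
    rcases QuantumGWA.map_x_degree φ hq_ne_one hh hu with ⟨hx, hy⟩ | ⟨hx, -⟩
    · exact QuantumGWA.mem_G_of_map_x_mem φ hq_ne_one hh hu hx hy
    · exact absurd (QuantumGWA.sq_eq_one_of_map_x_mem φ hq_ne_one hh hu hx) hq2
  · exact SemidirectProduct.exists_mulEquiv_of_involution _ _ (QuantumGWA.Omega_mul_self hq)
      (QuantumGWA.Omega_notMem_G hh hq)
      (QuantumGWA.mem_G_or_mul_Omega_mem_G hq_ne_one hh hu hq)
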